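/- For a group $X$, let $\mathcal K(X)$ be the set of all right cosets of all subgroups of $X$, which is a semigroup under $$Ha * Lb = \langle H,\ aLa^{-1}\rangle\, ab,$$ and let $\mathcal K_1(X)$ be the subsemigroup of $\mathcal K(X)$ consisting of all right cosets of all non-trivial subgroups of $X$. A minimal subgroup of $X$ is a minimal non-trivial subgroup. Let $\Omega_q(X)$ be the subgroup generated by all minimal subgroups of $X$ of order $q$, and let $\Omega(X)=\prod_{q}\Omega_q(X)$, over all primes $q$. **Theorem.** Let $p$ be a prime and let $G$ be a $p$-group (not necessarily finite) with $|\Omega(G)|=p$; write $K=\Omega(G)$ (so $K$ is the unique minimal subgroup of $G$). Let $\widetilde G$ be any group such that the semigroups $\mathcal K_1(G)$ and $\mathcal K_1(\widetilde G)$ are isomorphic. Then $\widetilde G$ has a unique minimal subgroup $\widetilde K$, the subgroup $\widetilde K$ is normal in $\widetilde G$, and $$G/K\cong \widetilde G/\widetilde K.$$ Moreover, if $G$ is finite and its order is composite, then $G\cong\widetilde G$. -/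

import Mathlib

/-- The right coset `H a = {h a | h ∈ H}`, as a subset of `G`. -/
def cosetSet {G : Type*} [Group G] (H : Subgroup G) (a : G) : Set G :=
  {x | ∃ h ∈ H, x = h * a}

theorem mem_cosetSet {G : Type*} [Group G] {H : Subgroup G} {a x : G} :
    x ∈ cosetSet H a ↔ x * a⁻¹ ∈ H := by
  constructor
  · rintro ⟨h, hh, rfl⟩
    simpa using hh
  · intro h
    exact ⟨x * a⁻¹, h, by simp⟩

/-- A right coset determines its subgroup, and its representative up to that subgroup. -/
theorem cosetSet_eq_iff {G : Type*} [Group G] {H K : Subgroup G} {a b : G} :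
    cosetSet H a = cosetSet K b ↔ H = K ∧ a * b⁻¹ ∈ H := by
  constructor
  · intro h
    have key : ∀ x, x * a⁻¹ ∈ H ↔ x * b⁻¹ ∈ K := fun x => by
      rw [← mem_cosetSet, h, mem_cosetSet]
    have ha : a * b⁻¹ ∈ K := (key a).1 (by simp)
    have hHK : H = K := by
      ext x
      have h1 := key (x * a)
      rw [mul_inv_cancel_right, mul_assoc, K.mul_mem_cancel_right ha] at h1
      exact h1
    exact ⟨hHK, hHK ▸ ha⟩
  · rintro ⟨rfl, h⟩
    ext x
    rw [mem_cosetSet, mem_cosetSet, ← H.mul_mem_cancel_right h]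
    simp [mul_assoc]

/-- The set `𝒦(G)` of all right cosets of all subgroups of `G`. -/
def CosetSemigroup (G : Type*) [Group G] : Type _ :=
  {A : Set G // ∃ (H : Subgroup G) (a : G), A = cosetSet H a}

namespace CosetSemigroup

variable {G : Type*} [Group G]

/-- The right coset `H a`, as an element of `𝒦(G)`. -/
def mk (H : Subgroup G) (a : G) : CosetSemigroup G := ⟨cosetSet H a, H, a, rfl⟩

theorem mk_eq_mk {H K : Subgroup G} {a b : G} :
    mk H a = mk K b ↔ H = K ∧ a * b⁻¹ ∈ H :=
  Subtype.ext_iff.trans cosetSet_eq_iff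

theorem exists_eq_mk (A : CosetSemigroup G) : ∃ (H : Subgroup G) (a : G), A = mk H a := by
  obtain ⟨_, H, a, rfl⟩ := A
  exact ⟨H, a, rfl⟩

/-- The conjugate `K^{a⁻¹} = a K a⁻¹`. -/
def conjSubgroup (a : G) (K : Subgroup G) : Subgroup G :=
  K.map (MulAut.conj a).toMonoidHom

/-- The product `H a * K b = ⟨H, K^{a⁻¹}⟩ a b`, written with chosen representatives;
`mk_mul_mk` below shows that the formula holds for all representatives. -/
noncomputable instance : Mul (CosetSemigroup G) where
  mul A B :=
    mk (A.exists_eq_mk.choose ⊔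
        conjSubgroup A.exists_eq_mk.choose_spec.choose B.exists_eq_mk.choose)
      (A.exists_eq_mk.choose_spec.choose * B.exists_eq_mk.choose_spec.choose)

theorem mem_conjSubgroup {a x : G} {K : Subgroup G} :
    x ∈ conjSubgroup a K ↔ a⁻¹ * x * a ∈ K := by
  constructor
  · rintro ⟨k, hk, rfl⟩
    simpa [mul_assoc] using hk
  · intro h
    exact ⟨_, h, by simp [mul_assoc]⟩

theorem conjSubgroup_mul (a b : G) (K : Subgroup G) :
    conjSubgroup (a * b) K = conjSubgroup a (conjSubgroup b K) := by
  ext x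
  simp [mem_conjSubgroup, mul_assoc]

theorem conjSubgroup_sup (a : G) (H K : Subgroup G) :
    conjSubgroup a (H ⊔ K) = conjSubgroup a H ⊔ conjSubgroup a K :=
  Subgroup.map_sup _ _ _

theorem sup_conjSubgroup_le {H K : Subgroup G} {a a' : G} (h : a * a'⁻¹ ∈ H) :
    H ⊔ conjSubgroup a K ≤ H ⊔ conjSubgroup a' K := by
  refine sup_le le_sup_left ?_
  intro x hx
  have h1 : a * a'⁻¹ ∈ H ⊔ conjSubgroup a' K := Subgroup.mem_sup_left h
  have h2 : (a * a'⁻¹)⁻¹ * x * (a * a'⁻¹) ∈ H ⊔ conjSubgroup a' K := by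
    refine Subgroup.mem_sup_right ?_
    rw [mem_conjSubgroup] at hx ⊢
    simpa [mul_assoc] using hx
  have h3 := mul_mem (mul_mem h1 h2) (inv_mem h1)
  simpa [mul_assoc] using h3

theorem mk_mul_aux {H K : Subgroup G} {a a' b b' : G} (ha : a * a'⁻¹ ∈ H) (hb : b * b'⁻¹ ∈ K) :
    mk (H ⊔ conjSubgroup a K) (a * b) = mk (H ⊔ conjSubgroup a' K) (a' * b') := by
  have ha' : a' * a⁻¹ ∈ H := by simpa using inv_mem ha
  refine mk_eq_mk.2 ⟨le_antisymm (sup_conjSubgroup_le ha) (sup_conjSubgroup_le ha'), ?_⟩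
  have h1 : a * (b * b'⁻¹) * a⁻¹ ∈ H ⊔ conjSubgroup a K := by
    refine Subgroup.mem_sup_right ?_
    rw [mem_conjSubgroup]
    simpa [mul_assoc] using hb
  have h2 := mul_mem h1 (Subgroup.mem_sup_left ha : a * a'⁻¹ ∈ H ⊔ conjSubgroup a K)
  simpa [mul_assoc] using h2

theorem mk_mul_mk (H K : Subgroup G) (a b : G) :
    mk H a * mk K b = mk (H ⊔ conjSubgroup a K) (a * b) := by
  have hA := (mk H a).exists_eq_mk.choose_spec.choose_spec
  have hB := (mk K b).exists_eq_mk.choose_spec.choose_spec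
  obtain ⟨h1, h2⟩ := mk_eq_mk.1 hA
  obtain ⟨h3, h4⟩ := mk_eq_mk.1 hB
  refine Eq.trans ?_ (mk_mul_aux (K := K) h2 h4).symm
  exact congrArg₂ (fun X Y => mk (X ⊔ conjSubgroup _ Y) _) h1.symm h3.symm

noncomputable instance : Semigroup (CosetSemigroup G) where
  mul_assoc A B C := by
    obtain ⟨H, a, rfl⟩ := A.exists_eq_mk
    obtain ⟨K, b, rfl⟩ := B.exists_eq_mk
    obtain ⟨L, c, rfl⟩ := C.exists_eq_mk
    simp only [mk_mul_mk, conjSubgroup_sup, conjSubgroup_mul, sup_assoc, mul_assoc]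

end CosetSemigroup

/-- The subsemigroup `𝒦₁(G)` of `𝒦(G)` of all right cosets of all non-trivial subgroups of `G`. -/
noncomputable def K₁ (G : Type*) [Group G] : Subsemigroup (CosetSemigroup G) where
  carrier := {A | ∃ (H : Subgroup G) (a : G), H ≠ ⊥ ∧ A = CosetSemigroup.mk H a}
  mul_mem' := by
    rintro _ _ ⟨H, a, hH, rfl⟩ ⟨K, b, -, rfl⟩
    exact ⟨_, _, fun h => hH (le_bot_iff.1 (h ▸ le_sup_left)), CosetSemigroup.mk_mul_mk H K a b⟩

/-- `Ω_p(G)`: the subgroup generated by all minimal subgroups of `G` of order `p`. Minimal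
subgroups are the minimal non-trivial subgroups, that is, the atoms of the subgroup lattice. -/
def OmegaPrime (G : Type*) [Group G] (p : ℕ) : Subgroup G :=
  sSup {H : Subgroup G | IsAtom H ∧ Nat.card H = p}

/-- `Ω(G) = ∏_p Ω_p(G)`, over all primes `p`. -/
def Omega (G : Type*) [Group G] : Subgroup G :=
  ⨆ p : Nat.Primes, OmegaPrime G p

instance OmegaPrime.normal (G : Type*) [Group G] (p : ℕ) : (OmegaPrime G p).Normal := by
  refine ⟨fun n hn g => ?_⟩
  have key : (OmegaPrime G p).map (MulAut.conj g).toMonoidHom ≤ OmegaPrime G p := by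
    rw [Subgroup.map_le_iff_le_comap]
    refine sSup_le ?_
    rintro H ⟨hH, hc⟩
    rw [← Subgroup.map_le_iff_le_comap]
    refine le_sSup ⟨?_, ?_⟩
    · exact ((MulAut.conj g).mapSubgroup.isAtom_iff H).2 hH
    · rw [← hc]
      exact (Nat.card_congr
        (H.equivMapOfInjective _ (MulAut.conj g).injective).toEquiv).symm
  exact key ⟨n, hn, by simp⟩

instance Omega.normal (G : Type*) [Group G] : (Omega G).Normal :=
  ⟨fun n hn g => by
    have key : (Omega G).map (MulAut.conj g).toMonoidHom ≤ Omega G := by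
      rw [Omega, Subgroup.map_iSup]
      refine iSup_mono fun p => ?_
      rintro _ ⟨x, hx, rfl⟩
      exact (OmegaPrime.normal G p).conj_mem x hx g
    exact key ⟨n, hn, by simp⟩⟩

/-!
A subgroup `K` is the least non-trivial subgroup of `X` precisely when the coset `K` is an identity
of `K₁ X`: `K * Ha = Ha` says `K ≤ H`. As `K` is invariant under conjugation, `Ka * Kb = Kab`, and
an invertible coset `Ha` has `H ≤ K`, so the invertible elements of `K₁ X` are the cosets of `K` and
form the group `X ⧸ K`. For a `p`-group with `|Ω(G)| = p` the least non-trivial subgroup is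
`Ω(G)`; an isomorphism of semigroups preserves the identity and the invertible elements, so `G'` has
a least non-trivial subgroup `K'` and `G ⧸ Ω(G) ≃* G' ⧸ K'`
(`CosetSemigroup.exists_isLeast_of_mulEquiv`, `CosetSemigroup.nonempty_quotient_mulEquiv`).

If `G` is finite of composite order, then `G' ⧸ K'` is a non-trivial `p`-group, which forces
`|K'| = p` (`card_eq_of_isLeast`). So `G` and `G'` are `p`-groups of the same order, each with a
unique subgroup of order `p`, and such groups are cyclic or generalized quaternion
(`isCyclic_or_quaternionGroup`). Two cyclic or two generalized quaternion groups of the same order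
are isomorphic, and the mixed case is excluded because a cyclic quotient by a central subgroup makes
the group abelian (`nonempty_mulEquiv_of_quotient`).

For the classification, take a maximal cyclic normal subgroup `⟨a⟩`. It is its own centralizer
(`exists_zpowers_normal_self_centralizing`). An element `x` of order `p` modulo `⟨a⟩` acts on it by
`a ↦ a ^ k`, and no element `a ^ i * x` has order `p`; computing `(a ^ i * x) ^ p` shows that this
is possible only for `p = 2` and `k = -1` (`eq_two_of_no_complement`, `inverts_of_pow_mem`). Since
`-1` is not a square modulo `4`, all elements outside `⟨a⟩` invert `a`, so `⟨a⟩` has index at most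
two, and the generalized quaternion relations hold.
-/

/-! ### The identity of the semigroup and its invertible elements -/

namespace CosetSemigroup

variable {X Y : Type*} [Group X] [Group Y]

/-- The coset `H a` of a non-trivial subgroup, as an element of `K₁ X`. -/
def mk₁ (H : Subgroup X) (hH : H ≠ ⊥) (a : X) : K₁ X := ⟨mk H a, H, a, hH, rfl⟩

theorem exists_eq_mk₁ (A : K₁ X) : ∃ (H : Subgroup X) (hH : H ≠ ⊥) (a : X), A = mk₁ H hH a := by
  obtain ⟨_, H, a, hH, rfl⟩ := A
  exact ⟨H, hH, a, rfl⟩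

theorem mk₁_eq_mk₁ {H L : Subgroup X} {hH : H ≠ ⊥} {hL : L ≠ ⊥} {a b : X} :
    mk₁ H hH a = mk₁ L hL b ↔ H = L ∧ a * b⁻¹ ∈ H :=
  Subtype.ext_iff.trans mk_eq_mk

theorem mk₁_mul_mk₁ (H L : Subgroup X) (hH : H ≠ ⊥) (hL : L ≠ ⊥) (a b : X) :
    mk₁ H hH a * mk₁ L hL b =
      mk₁ (H ⊔ conjSubgroup a L) (fun h => hH (le_bot_iff.1 (h ▸ le_sup_left))) (a * b) :=
  Subtype.ext (mk_mul_mk H L a b)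

theorem conjSubgroup_of_normal (a : X) (K : Subgroup X) [K.Normal] : conjSubgroup a K = K := by
  ext x
  rw [mem_conjSubgroup]
  simpa using ‹K.Normal›.mem_comm_iff (a := a⁻¹ * x) (b := a)

theorem conjSubgroup_ne_bot {H : Subgroup X} (hH : H ≠ ⊥) (a : X) : conjSubgroup a H ≠ ⊥ := by
  rwa [conjSubgroup, Ne, Subgroup.map_eq_bot_iff_of_injective _ (MulAut.conj a).injective]

/-- A least non-trivial subgroup is normal, since its conjugates are non-trivial as well. -/
theorem normal_of_isLeast {K : Subgroup X} (hK : IsLeast {H : Subgroup X | H ≠ ⊥} K) :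
    K.Normal := by
  refine ⟨fun n hn g => ?_⟩
  have := hK.2 (conjSubgroup_ne_bot hK.1 g⁻¹) hn
  simpa [mem_conjSubgroup] using this

/-- A least non-trivial subgroup `K` gives a two-sided identity of `K₁ X`. -/
theorem mk₁_one_isIdentity {K : Subgroup X} (hK : IsLeast {H : Subgroup X | H ≠ ⊥} K)
    (A : K₁ X) : mk₁ K hK.1 1 * A = A ∧ A * mk₁ K hK.1 1 = A := by
  obtain ⟨H, hH, a, rfl⟩ := exists_eq_mk₁ A
  have := normal_of_isLeast hK
  simp only [mk₁_mul_mk₁, mk₁_eq_mk₁, conjSubgroup_of_normal]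
  refine ⟨⟨?_, by simp⟩, ⟨sup_eq_left.2 (hK.2 hH), by simp⟩⟩
  have h1 : conjSubgroup 1 H = H := by ext; simp [mem_conjSubgroup]
  rw [h1]
  exact sup_eq_right.2 (hK.2 hH)

/-- Conversely, an identity of `K₁ X` is a least non-trivial subgroup. -/
theorem exists_isLeast_of_isIdentity {E : K₁ X} (hE : ∀ A, E * A = A) :
    ∃ (K : Subgroup X) (hK : IsLeast {H : Subgroup X | H ≠ ⊥} K), E = mk₁ K hK.1 1 := by
  obtain ⟨K, hK, a, rfl⟩ := exists_eq_mk₁ E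
  have ha : a ∈ K := by
    obtain ⟨h1, h2⟩ := mk₁_eq_mk₁.1 ((mk₁_mul_mk₁ ..).symm.trans (hE (mk₁ K hK a)))
    rw [h1] at h2
    simpa using h2
  have h1 : mk₁ K hK a = mk₁ K hK 1 := mk₁_eq_mk₁.2 ⟨rfl, by simpa using ha⟩
  refine ⟨K, ⟨hK, fun L hL => ?_⟩, h1⟩
  have h2 := hE (mk₁ L hL 1)
  rw [h1, mk₁_mul_mk₁] at h2
  exact (mk₁_eq_mk₁.1 h2).1 ▸ le_sup_left

/-- An isomorphism `K₁ X ≃* K₁ Y` transports a least non-trivial subgroup. -/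
theorem exists_isLeast_of_mulEquiv (e : K₁ X ≃* K₁ Y) {K : Subgroup X}
    (hK : IsLeast {H : Subgroup X | H ≠ ⊥} K) :
    ∃ (K' : Subgroup Y) (hK' : IsLeast {H : Subgroup Y | H ≠ ⊥} K'),
      e (mk₁ K hK.1 1) = mk₁ K' hK'.1 1 :=
  exists_isLeast_of_isIdentity fun A => by
    obtain ⟨B, rfl⟩ := e.surjective A
    rw [← map_mul, (mk₁_one_isIdentity hK B).1]

theorem mk₁_mul_mk₁_of_isLeast {K : Subgroup X} (hK : IsLeast {H : Subgroup X | H ≠ ⊥} K)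
    (a b : X) : mk₁ K hK.1 a * mk₁ K hK.1 b = mk₁ K hK.1 (a * b) := by
  have := normal_of_isLeast hK
  rw [mk₁_mul_mk₁, mk₁_eq_mk₁]
  simp [conjSubgroup_of_normal]

/-- The cosets of a least non-trivial subgroup are invertible, and are therefore carried to
cosets of the least non-trivial subgroup of the other group. -/
theorem exists_apply_eq_mk₁ (e : K₁ X ≃* K₁ Y) {K : Subgroup X} {K' : Subgroup Y}
    (hK : IsLeast {H : Subgroup X | H ≠ ⊥} K) (hK' : IsLeast {H : Subgroup Y | H ≠ ⊥} K')
    (he : e (mk₁ K hK.1 1) = mk₁ K' hK'.1 1) (g : X) :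
    ∃ g' : Y, e (mk₁ K hK.1 g) = mk₁ K' hK'.1 g' := by
  obtain ⟨H, hH, a, h1⟩ := exists_eq_mk₁ (e (mk₁ K hK.1 g))
  obtain ⟨L, hL, b, h2⟩ := exists_eq_mk₁ (e (mk₁ K hK.1 g⁻¹))
  have h3 : e (mk₁ K hK.1 g) * e (mk₁ K hK.1 g⁻¹) = mk₁ K' hK'.1 1 := by
    rw [← map_mul, mk₁_mul_mk₁_of_isLeast hK, mul_inv_cancel, he]
  rw [h1, h2, mk₁_mul_mk₁] at h3
  have h4 : H ≤ K' := (mk₁_eq_mk₁.1 h3).1 ▸ le_sup_left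
  obtain rfl := le_antisymm h4 (hK'.2 hH)
  exact ⟨a, h1⟩

/-- The invertible elements of `K₁ X` are the cosets of the least non-trivial subgroup `K`, and
form the group `X ⧸ K`; hence this quotient is an invariant of `K₁ X`. -/
theorem nonempty_quotient_mulEquiv (e : K₁ X ≃* K₁ Y) {K : Subgroup X} {K' : Subgroup Y}
    [K.Normal] [K'.Normal]
    (hK : IsLeast {H : Subgroup X | H ≠ ⊥} K) (hK' : IsLeast {H : Subgroup Y | H ≠ ⊥} K')
    (he : e (mk₁ K hK.1 1) = mk₁ K' hK'.1 1) : Nonempty (X ⧸ K ≃* Y ⧸ K') := by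
  choose f hf using exists_apply_eq_mk₁ e hK hK' he
  have hcoe : ∀ a b : Y, mk₁ K' hK'.1 a = mk₁ K' hK'.1 b ↔ (a : Y ⧸ K') = (b : Y ⧸ K') := by
    intro a b
    rw [mk₁_eq_mk₁, QuotientGroup.eq_iff_div_mem, div_eq_mul_inv]
    simp
  let ψ : X →* Y ⧸ K' := MonoidHom.mk' (fun g => (f g : Y ⧸ K')) fun a b => by
    rw [← QuotientGroup.mk_mul, ← hcoe, ← hf, ← mk₁_mul_mk₁_of_isLeast hK,
      map_mul, hf, hf, mk₁_mul_mk₁_of_isLeast hK']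
  have hψ : Function.Surjective ψ := by
    intro y
    obtain ⟨b, rfl⟩ := QuotientGroup.mk_surjective y
    obtain ⟨a, ha⟩ := exists_apply_eq_mk₁ e.symm hK' hK (by rw [← he, e.symm_apply_apply]) b
    refine ⟨a, (hcoe _ _).1 ?_⟩
    rw [← hf, ← ha, e.apply_symm_apply]
  have hker : K = ψ.ker := by
    ext x
    rw [MonoidHom.mem_ker]
    change x ∈ K ↔ (f x : Y ⧸ K') = ((1 : Y) : Y ⧸ K')
    rw [← hcoe, ← hf, ← he, e.injective.eq_iff, mk₁_eq_mk₁]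
    simp
  exact ⟨(QuotientGroup.quotientMulEquivOfEq hker).trans
    (QuotientGroup.quotientKerEquivOfSurjective ψ hψ)⟩

end CosetSemigroup

/-! ### Elements of order `p` modulo a normal subgroup -/

section Classification

variable {G : Type*} [Group G] {p : ℕ}

theorem IsPGroup.exists_pow_ne_one_pow_eq_one (hG : IsPGroup p G) {w : G} (hw : w ≠ 1) :
    ∃ k : ℕ, w ^ p ^ k ≠ 1 ∧ (w ^ p ^ k) ^ p = 1 := by
  classical
  have h := hG w
  obtain ⟨k, hk⟩ : ∃ k, Nat.find h = k + 1 := Nat.exists_eq_succ_of_ne_zero fun h0 => by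
    have := Nat.find_spec h
    rw [h0] at this
    exact hw (by simpa using this)
  refine ⟨k, Nat.find_min h (by lia), ?_⟩
  have := Nat.find_spec h
  rwa [hk, pow_succ, pow_mul] at this

theorem IsPGroup.exists_pow_notMem_pow_mem {A : Subgroup G} [A.Normal] (hQ : IsPGroup p (G ⧸ A))
    {f : G} (hf : f ∉ A) : ∃ k : ℕ, f ^ p ^ k ∉ A ∧ (f ^ p ^ k) ^ p ∈ A := by
  obtain ⟨k, h1, h2⟩ := hQ.exists_pow_ne_one_pow_eq_one (w := (f : G ⧸ A))
    (by rwa [Ne, QuotientGroup.eq_one_iff])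
  rw [← QuotientGroup.mk_pow, Ne, QuotientGroup.eq_one_iff] at h1
  rw [← QuotientGroup.mk_pow, ← QuotientGroup.mk_pow, QuotientGroup.eq_one_iff] at h2
  exact ⟨k, h1, h2⟩

/-- A non-trivial normal subgroup of a finite `p`-group contains a central element of order `p`. -/
theorem IsPGroup.exists_mem_center_of_normal [Finite G] (hp : p.Prime) (hG : IsPGroup p G)
    (N : Subgroup G) [N.Normal] (hN : N ≠ ⊥) :
    ∃ w ∈ N, w ∈ Subgroup.center G ∧ w ≠ 1 ∧ w ^ p = 1 := by
  have := Fact.mk hp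
  have hdvd : p ∣ Nat.card N := (hG.to_subgroup N).card_eq_or_dvd.resolve_left fun h =>
    hN (Subgroup.card_eq_one.1 h)
  have h1 : (1 : N) ∈ MulAction.fixedPoints (ConjAct G) N := fun g => smul_one g
  obtain ⟨b, hb, hb1⟩ := (hG.of_equiv
    ConjAct.toConjAct).exists_fixed_point_of_prime_dvd_card_of_fixed_point N hdvd h1
  have hb' : (b : G) ≠ 1 := fun h => hb1 (Subtype.ext h.symm)
  have hc : (b : G) ∈ Subgroup.center G := by
    rw [Subgroup.mem_center_iff]
    intro g
    have : g * (b : G) * g⁻¹ = b := congrArg Subtype.val (hb (ConjAct.toConjAct g))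
    exact mul_inv_eq_iff_eq_mul.1 this
  obtain ⟨k, h2, h3⟩ := hG.exists_pow_ne_one_pow_eq_one hb'
  exact ⟨_, N.pow_mem b.2 _, Subgroup.pow_mem _ hc _, h2, h3⟩

theorem Subgroup.zpowers_normal_of_forall {y : G} (h : ∀ g : G, g * y * g⁻¹ ∈ zpowers y) :
    (zpowers y).Normal := by
  refine ⟨?_⟩
  rintro _ ⟨i, rfl⟩ g
  change g * y ^ i * g⁻¹ ∈ _
  rw [← conj_zpow]
  exact zpow_mem (h g) i

/-! ### A self-centralizing cyclic normal subgroup -/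

/-- If the elements of order `p` of a finite `p`-group all generate the same subgroup, then a
maximal cyclic normal subgroup is its own centralizer. -/
theorem exists_zpowers_normal_self_centralizing [Finite G] [Nontrivial G] (hp : p.Prime)
    (hG : IsPGroup p G)
    (hU : ∀ g h : G, g ≠ 1 → g ^ p = 1 → h ^ p = 1 → h ∈ Subgroup.zpowers g) :
    ∃ a : G, a ≠ 1 ∧ (Subgroup.zpowers a).Normal ∧
      ∀ y, Commute y a → y ∈ Subgroup.zpowers a := by
  obtain ⟨z, -, hz, hz1, -⟩ := hG.exists_mem_center_of_normal hp ⊤ top_ne_bot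
  obtain ⟨A, hA⟩ := (Set.toFinite {H : Subgroup G | ∃ a, a ≠ 1 ∧ H = Subgroup.zpowers a ∧
    H.Normal}).exists_maximal ⟨_, z, hz1, rfl, Subgroup.zpowers_normal_of_forall fun g => by
      rw [Subgroup.mem_center_iff.1 hz g, mul_inv_cancel_right]
      exact Subgroup.mem_zpowers z⟩
  obtain ⟨a, ha1, rfl, hn⟩ := hA.prop
  refine ⟨a, ha1, hn, fun y₀ hy₀ => ?_⟩
  by_contra hy₀A
  -- the centralizer modulo `⟨a⟩` is a non-trivial normal subgroup of the quotient
  have hC : (Subgroup.centralizer (Subgroup.zpowers a : Set G)).Normal := inferInstance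
  let N := (Subgroup.centralizer (Subgroup.zpowers a : Set G)).map
    (QuotientGroup.mk' (Subgroup.zpowers a))
  have hmemC : ∀ y, y ∈ Subgroup.centralizer (Subgroup.zpowers a : Set G) ↔ Commute y a := by
    intro y
    rw [Subgroup.mem_centralizer_iff]
    refine ⟨fun h => (h a (Subgroup.mem_zpowers a)).symm, ?_⟩
    rintro h _ ⟨i, rfl⟩
    exact (h.zpow_right i).symm.eq
  have hNn : N.Normal := hC.map _ (QuotientGroup.mk'_surjective _)
  have hN : N ≠ ⊥ := fun h => by
    have : (QuotientGroup.mk' (Subgroup.zpowers a)) y₀ ∈ N :=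
      Subgroup.mem_map_of_mem _ ((hmemC _).2 hy₀)
    rw [h, Subgroup.mem_bot] at this
    exact hy₀A ((QuotientGroup.eq_one_iff _).1 this)
  obtain ⟨w, ⟨y, hyC, rfl⟩, hwc, hw1, hwp⟩ :=
    (hG.to_quotient (Subgroup.zpowers a)).exists_mem_center_of_normal hp N hN
  replace hyC : Commute y a := (hmemC y).1 hyC
  have hyA : y ∉ Subgroup.zpowers a := fun h => hw1 ((QuotientGroup.eq_one_iff _).2 h)
  obtain ⟨j, hj⟩ : y ^ p ∈ Subgroup.zpowers a := (QuotientGroup.eq_one_iff _).1 hwp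
  have hcomm : ∀ g, g * y * g⁻¹ * y⁻¹ ∈ Subgroup.zpowers a := fun g => by
    rw [← QuotientGroup.eq_one_iff]
    have := Subgroup.mem_center_iff.1 hwc (g : G ⧸ Subgroup.zpowers a)
    simp only [QuotientGroup.mk'_apply] at this
    simp [this]
  by_cases hpj : (p : ℤ) ∣ j
  · -- a translate of `y` by a power of `a` has order `p`, hence lies in `⟨a⟩`
    obtain ⟨i, rfl⟩ := hpj
    obtain ⟨k, hk1, hk2⟩ := hG.exists_pow_ne_one_pow_eq_one ha1
    have h1 : (y * a ^ (-i)) ^ p = 1 := by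
      rw [(hyC.zpow_right _).mul_pow, ← hj, ← zpow_natCast (a ^ (-i)), ← zpow_mul, ← zpow_add]
      simp [mul_comm]
    have h2 : y * a ^ (-i) ∈ Subgroup.zpowers a :=
      Subgroup.zpowers_le.2 (Subgroup.npow_mem_zpowers a _) (hU _ _ hk1 hk2 h1)
    exact hyA ((Subgroup.mul_mem_cancel_right _ (Subgroup.zpow_mem_zpowers a _)).1 h2)
  · -- `a` is a power of `y`, so that `⟨y⟩` is a larger cyclic normal subgroup
    obtain ⟨m, hm⟩ := hG a
    have hcop : IsCoprime j ((p : ℤ) ^ m) :=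
      (((Nat.prime_iff_prime_int.1 hp).coprime_iff_not_dvd.2 hpj).symm).pow_right
    obtain ⟨u, v, huv⟩ := hcop
    have hay : a ∈ Subgroup.zpowers y := by
      refine ⟨p * u, ?_⟩
      change y ^ ((p : ℤ) * u) = a
      have hm' : a ^ ((p : ℤ) ^ m) = 1 := by exact_mod_cast hm
      rw [zpow_mul, zpow_natCast, ← hj]
      change (a ^ j) ^ u = a
      calc (a ^ j) ^ u = a ^ (u * j) * (a ^ ((p : ℤ) ^ m)) ^ v := by
            rw [hm', one_zpow, mul_one, ← zpow_mul, mul_comm]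
        _ = a ^ (u * j + v * (p : ℤ) ^ m) := by
            rw [zpow_add, ← zpow_mul, mul_comm v]
        _ = a := by rw [huv, zpow_one]
    have hle : Subgroup.zpowers a ≤ Subgroup.zpowers y := Subgroup.zpowers_le.2 hay
    refine hyA (hA.le_of_ge ⟨y, fun h => hyA (h ▸ one_mem _), rfl,
      Subgroup.zpowers_normal_of_forall fun g => ?_⟩ hle (Subgroup.mem_zpowers y))
    simpa using mul_mem (hle (hcomm g)) (Subgroup.mem_zpowers y)

/-! ### The action on the cyclic normal subgroup -/

/-- The arithmetic behind the classification. Let `x` act on `⟨a⟩`, cyclic of order `p ^ m`, by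
`a ↦ a ^ k`, and let `x ^ p = a ^ j`. Then `(a ^ i * x) ^ p = a ^ (i * (1 + k + ⋯ + k ^ (p - 1)) + j)`.
If no choice of `i` makes this trivial, then `p = 2`, `k = -1` and `a ^ j` has order two. -/
theorem eq_two_of_no_complement {p m : ℕ} (hp : p.Prime) {k j : ℤ}
    (h1 : (p : ℤ) ^ m ∣ k ^ p - 1) (h2 : ¬ (p : ℤ) ^ m ∣ k - 1) (h3 : (p : ℤ) ^ m ∣ (k - 1) * j)
    (h4 : ∀ i : ℤ, ¬ (p : ℤ) ^ m ∣ i * (∑ t ∈ Finset.range p, k ^ t) + j) :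
    p = 2 ∧ 2 ≤ m ∧ (p : ℤ) ^ m ∣ k + 1 ∧ (p : ℤ) ^ m ∣ 2 * j := by
  have := Fact.mk hp
  have hpZ : Prime (p : ℤ) := Nat.prime_iff_prime_int.1 hp
  have hm : m ≠ 0 := by rintro rfl; simp at h2
  have hk : (p : ℤ) ∣ k - 1 := by
    have h5 : (p : ℤ) ∣ k ^ p - 1 := (dvd_pow_self _ hm).trans h1
    rw [← ZMod.intCast_zmod_eq_zero_iff_dvd] at h5 ⊢
    simpa [ZMod.pow_card] using h5
  have hj : (p : ℤ) ∣ j := by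
    by_contra hj
    have hcop : IsCoprime ((p : ℤ) ^ m) j := (hpZ.coprime_iff_not_dvd.2 hj).pow_left
    exact h2 (hcop.dvd_of_dvd_mul_right h3)
  obtain ⟨b, hb⟩ := hk
  obtain rfl : k = 1 + p * b := by linarith
  set N := ∑ t ∈ Finset.range p, (1 + (p : ℤ) * b) ^ t with hN
  have hpN : (p : ℤ) ∣ N := by
    rw [← ZMod.intCast_zmod_eq_zero_iff_dvd]
    simp [hN]
  -- otherwise `N` is `p` times a unit modulo `p ^ m`, and `i` exists
  have hp2 : (p : ℤ) ^ 2 ∣ N := by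
    by_contra hp2
    obtain ⟨n, hn⟩ := hpN
    obtain ⟨j', hj'⟩ := hj
    have hn' : ¬ (p : ℤ) ∣ n := fun ⟨c, hc⟩ => hp2 ⟨c, by rw [hn, hc]; ring⟩
    have hcop : IsCoprime ((p : ℤ) ^ m) n := (hpZ.coprime_iff_not_dvd.2 hn').pow_left
    obtain ⟨u, v, huv⟩ := hcop
    refine h4 (-j' * v) ⟨p * j' * u, ?_⟩
    rw [hn, hj']
    linear_combination (-p * j') * huv
  obtain rfl : p = 2 := by
    by_contra hne
    have h5 := odd_sq_dvd_geom_sum₂_sub (R := ℤ) (a := 1) (b := b) (hp.odd_of_ne_two hne)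
    simp only [one_pow, mul_one] at h5
    have h6 : (p : ℤ) ^ 2 ∣ p := by
      rw [← hN] at h5
      simpa using dvd_sub hp2 h5
    have h7 : p ^ 2 ∣ p := by exact_mod_cast h6
    have := Nat.le_of_dvd hp.pos h7
    nlinarith [hp.two_le]
  have hN2 : N = 2 + 2 * b := by simp [hN, Finset.sum_range_succ]; ring
  rw [hN2] at hp2 h4
  push_cast at *
  have hbo : IsCoprime ((2 : ℤ) ^ m) b := by
    refine ((Int.prime_two.coprime_iff_not_dvd).2 ?_).pow_left
    lia
  have hm2 : 2 ≤ m := by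
    by_contra hlt
    obtain rfl : m = 1 := by lia
    exact h2 (by simp)
  have hj2 : (2 : ℤ) ^ m ∣ 2 * j := by
    refine hbo.dvd_of_dvd_mul_left ?_
    have : b * (2 * j) = (1 + 2 * b - 1) * j := by ring
    rwa [this]
  have hN3 : (2 : ℤ) ^ m ∣ 2 * (2 + 2 * b) := by
    refine hbo.dvd_of_dvd_mul_left ?_
    have : b * (2 * (2 + 2 * b)) = (1 + 2 * b) ^ 2 - 1 := by ring
    rwa [this]
  refine ⟨trivial, hm2, ?_, hj2⟩
  -- otherwise `1 + k` and `j` are both `2 ^ (m - 1)` modulo `2 ^ m`, and `i = 1` works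
  by_contra hcon
  obtain ⟨r, rfl⟩ : ∃ r, m = r + 1 := ⟨m - 1, by lia⟩
  rw [pow_succ'] at *
  obtain ⟨c, hc⟩ := hN3
  obtain ⟨d, hd⟩ := hj2
  have hc' : 2 + 2 * b = 2 ^ r * c := by linarith
  have hd' : j = 2 ^ r * d := by linarith
  have hco : ¬ 2 ∣ c := by
    rintro ⟨c', rfl⟩
    exact hcon ⟨c', by linarith⟩
  have hdo : ¬ 2 ∣ d := by
    rintro ⟨d', rfl⟩
    exact h4 0 ⟨d', by linarith⟩
  obtain ⟨s, hs⟩ : 2 ∣ c + d := by lia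
  exact h4 1 ⟨s, by rw [hc', hd']; linear_combination 2 ^ r * hs⟩

theorem conj_pow_zpow_eq {a x : G} {k : ℤ} (hx : x * a * x⁻¹ = a ^ k) (n : ℕ) (i : ℤ) :
    x ^ n * a ^ i = a ^ (k ^ n * i) * x ^ n := by
  induction n generalizing i with
  | zero => simp
  | succ n ih =>
    have h1 : x * a ^ i = a ^ (k * i) * x := by
      rw [← mul_inv_eq_iff_eq_mul, ← conj_zpow, hx, ← zpow_mul]
    rw [pow_succ, mul_assoc, h1, ← mul_assoc, ih, mul_assoc, pow_succ, mul_assoc]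

theorem zpow_mul_pow_eq {a x : G} {k : ℤ} (hx : x * a * x⁻¹ = a ^ k) (i : ℤ) (n : ℕ) :
    (a ^ i * x) ^ n = a ^ (i * ∑ t ∈ Finset.range n, k ^ t) * x ^ n := by
  induction n with
  | zero => simp
  | succ n ih =>
    rw [pow_succ, ih, Finset.sum_range_succ, mul_assoc, ← mul_assoc (x ^ n), conj_pow_zpow_eq hx,
      pow_succ, ← mul_assoc, ← mul_assoc, ← zpow_add, mul_assoc]
    congr 2
    ring

/-- An element of order `p` modulo a self-centralizing cyclic normal subgroup `⟨a⟩` that contains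
all elements of order `p` forces `p = 2`, inverts `a`, and squares to the involution of `⟨a⟩`. -/
theorem inverts_of_pow_mem (hp : p.Prime) {a x : G} {m : ℕ} (hm : orderOf a = p ^ m)
    (hn : (Subgroup.zpowers a).Normal) (hC : ∀ y, Commute y a → y ∈ Subgroup.zpowers a)
    (hA : ∀ g : G, g ^ p = 1 → g ∈ Subgroup.zpowers a)
    (hx : x ∉ Subgroup.zpowers a) (hxp : x ^ p ∈ Subgroup.zpowers a) :
    p = 2 ∧ 2 ≤ m ∧ x * a * x⁻¹ = a⁻¹ ∧ x ^ 2 = a ^ 2 ^ (m - 1) := by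
  obtain ⟨k, hk⟩ := hn.conj_mem a (Subgroup.mem_zpowers a) x
  replace hk : x * a * x⁻¹ = a ^ k := hk.symm
  obtain ⟨j, hj⟩ := hxp
  replace hj : x ^ p = a ^ j := hj.symm
  have hdvd : ∀ i : ℤ, (p : ℤ) ^ m ∣ i ↔ a ^ i = 1 := fun i => by
    rw [← orderOf_dvd_iff_zpow_eq_one, hm]; push_cast; rfl
  have hdvd' : ∀ i i' : ℤ, (p : ℤ) ^ m ∣ i - i' ↔ a ^ i = a ^ i' := fun i i' => by
    rw [hdvd, zpow_sub, mul_inv_eq_one]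
  have h1 : (p : ℤ) ^ m ∣ k ^ p - 1 := by
    rw [hdvd', zpow_one]
    have := conj_pow_zpow_eq hk p 1
    rw [hj, mul_one, ← zpow_add, add_comm, zpow_add, zpow_one] at this
    exact (mul_right_cancel this).symm
  have h2 : ¬ (p : ℤ) ^ m ∣ k - 1 := by
    rw [hdvd', zpow_one]
    intro h
    exact hx (hC x (mul_inv_eq_iff_eq_mul.1 (hk.trans h)))
  have h3 : (p : ℤ) ^ m ∣ (k - 1) * j := by
    rw [sub_mul, one_mul, hdvd']
    have := conj_pow_zpow_eq hk 1 j
    rw [pow_one, pow_one, ← hj, ← pow_succ', pow_succ] at this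
    rw [← hj]
    exact (mul_right_cancel this).symm
  have h4 : ∀ i : ℤ, ¬ (p : ℤ) ^ m ∣ i * (∑ t ∈ Finset.range p, k ^ t) + j := by
    intro i
    rw [hdvd, zpow_add, ← hj, ← zpow_mul_pow_eq hk]
    intro h
    exact hx ((Subgroup.mul_mem_cancel_left _ (Subgroup.zpow_mem_zpowers a i)).1 (hA _ h))
  obtain ⟨rfl, hm2, h5, h6⟩ := eq_two_of_no_complement hp h1 h2 h3 h4
  refine ⟨rfl, hm2, ?_, ?_⟩
  · rw [← sub_neg_eq_add, hdvd', zpow_neg, zpow_one] at h5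
    rw [hk, h5]
  · rw [hj, ← zpow_natCast, ← hdvd']
    have h7 := h4 0
    obtain ⟨r, rfl⟩ : ∃ r, m = r + 1 := ⟨m - 1, by lia⟩
    push_cast at *
    rw [pow_succ'] at *
    obtain ⟨d, hd⟩ := h6
    have hd' : j = 2 ^ r * d := by linarith
    have hdo : ¬ 2 ∣ d := by
      rintro ⟨d', rfl⟩
      exact h7 ⟨d', by linarith⟩
    obtain ⟨s, hs⟩ : 2 ∣ d - 1 := by lia
    refine ⟨s, ?_⟩
    rw [hd']
    linear_combination 2 ^ r * hs

/-! ### Recognition of the generalized quaternion groups -/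

/-- A group with the standard presentation data of a generalized quaternion group is one. -/
theorem nonempty_quaternionGroup_mulEquiv {n : ℕ} [NeZero n] {a x : G} (ha : orderOf a = 2 * n)
    (hxa : x * a * x⁻¹ = a⁻¹) (hx2 : x ^ 2 = a ^ n) (hx : x ∉ Subgroup.zpowers a)
    (hcov : ∀ g, g ∈ Subgroup.zpowers a ∨ x⁻¹ * g ∈ Subgroup.zpowers a) :
    Nonempty (QuaternionGroup n ≃* G) := by
  let φ : ZMod (2 * n) →+ Additive G := ZMod.lift (2 * n) ⟨zmultiplesHom _ (Additive.ofMul a), by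
    rw [zmultiplesHom_apply, natCast_zsmul, ← ofMul_pow, ← ha, pow_orderOf_eq_one, ofMul_one]⟩
  let P : ZMod (2 * n) → G := fun i => (φ i).toMul
  have hP : ∀ i : ℤ, P i = a ^ i := fun i => by
    simp only [P, φ, ZMod.lift_coe, zmultiplesHom_apply, ← ofMul_zpow, toMul_ofMul]
  have hadd : ∀ i j, P (i + j) = P i * P j := fun i j => by simp [P]
  have hPn : P n = x * x := by
    have := hP n
    rw [zpow_natCast, ← hx2, sq] at this
    exact_mod_cast this
  have hinj : Function.Injective P := by
    intro i j hij
    obtain ⟨i, rfl⟩ := ZMod.intCast_surjective i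
    obtain ⟨j, rfl⟩ := ZMod.intCast_surjective j
    rw [hP, hP, ← mul_inv_eq_one, ← zpow_sub, ← orderOf_dvd_iff_zpow_eq_one, ha] at hij
    rwa [← sub_eq_zero, ← Int.cast_sub, ZMod.intCast_zmod_eq_zero_iff_dvd]
  have hcomm : ∀ i, P i * x = x * P (-i) := by
    intro i
    obtain ⟨i, rfl⟩ := ZMod.intCast_surjective i
    rw [← Int.cast_neg, hP, hP]
    have := conj_pow_zpow_eq (k := -1) (by rw [hxa, zpow_neg, zpow_one]) 1 (-i)
    simpa using this.symm
  have hmem : ∀ i, P i ∈ Subgroup.zpowers a := by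
    intro i
    obtain ⟨i, rfl⟩ := ZMod.intCast_surjective i
    rw [hP]
    exact Subgroup.zpow_mem_zpowers a i
  have hsurj : ∀ g ∈ Subgroup.zpowers a, ∃ i, P i = g := by
    rintro _ ⟨i, rfl⟩
    exact ⟨i, hP i⟩
  let F : QuaternionGroup n → G
    | .a i => P i
    | .xa i => x * P i
  let f : QuaternionGroup n →* G := MonoidHom.mk' F (by
    rintro (i | i) (j | j)
    · exact hadd i j
    · change x * P (j - i) = P i * (x * P j)
      rw [← mul_assoc, hcomm, mul_assoc, ← hadd, neg_add_eq_sub]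
    · change x * P (i + j) = x * P i * P j
      rw [hadd, mul_assoc]
    · change P ((n : ZMod (2 * n)) + j - i) = x * P i * (x * P j)
      rw [mul_assoc x, ← mul_assoc (P i), hcomm, mul_assoc x, ← hadd, ← mul_assoc, ← hPn, ← hadd]
      congr 1
      ring)
  refine ⟨MulEquiv.ofBijective f ⟨(injective_iff_map_eq_one f).2 ?_, fun g => ?_⟩⟩
  · rintro (i | i) h
    · change P i = 1 at h
      have h0 : P 0 = 1 := by simpa using hP 0
      rw [hinj (h.trans h0.symm), QuaternionGroup.one_def]
    · change x * P i = 1 at h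
      exact absurd ((Subgroup.mul_mem_cancel_right _ (hmem i)).1 (h ▸ one_mem _)) hx
  · rcases hcov g with h | h
    · obtain ⟨i, hi⟩ := hsurj _ h
      exact ⟨.a i, hi⟩
    · obtain ⟨i, hi⟩ := hsurj _ h
      exact ⟨.xa i, show x * P i = g by rw [hi, mul_inv_cancel_left]⟩

/-- A finite `p`-group with a unique subgroup of order `p` is cyclic or generalized quaternion. -/
theorem isCyclic_or_quaternionGroup [Finite G] (hp : p.Prime) (hG : IsPGroup p G)
    (hU : ∀ g h : G, g ≠ 1 → g ^ p = 1 → h ^ p = 1 → h ∈ Subgroup.zpowers g) :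
    IsCyclic G ∨ ∃ r : ℕ, 1 ≤ r ∧ Nonempty (QuaternionGroup (2 ^ r) ≃* G) := by
  rcases subsingleton_or_nontrivial G with _ | _
  · exact Or.inl inferInstance
  obtain ⟨a, ha1, hn, hC⟩ := exists_zpowers_normal_self_centralizing hp hG hU
  have hA : ∀ g : G, g ^ p = 1 → g ∈ Subgroup.zpowers a := by
    obtain ⟨k, hk1, hk2⟩ := hG.exists_pow_ne_one_pow_eq_one ha1
    exact fun g hg => Subgroup.zpowers_le.2 (Subgroup.npow_mem_zpowers a _) (hU _ _ hk1 hk2 hg)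
  have := Fact.mk hp
  obtain ⟨m, hm⟩ := IsPGroup.iff_orderOf.1 hG a
  by_cases htop : ∀ g : G, g ∈ Subgroup.zpowers a
  · exact Or.inl ⟨a, htop⟩
  right
  push Not at htop
  have key := fun {x : G} => inverts_of_pow_mem (x := x) hp hm hn hC hA
  have hQ := hG.to_quotient (Subgroup.zpowers a)
  obtain ⟨f₀, hf₀⟩ := htop
  obtain ⟨k₀, hx, hxp⟩ := hQ.exists_pow_notMem_pow_mem hf₀
  obtain ⟨rfl, hm2, hxa, hx2⟩ := key hx hxp
  generalize f₀ ^ 2 ^ k₀ = x at *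
  -- every element outside `⟨a⟩` inverts `a`, since `-1` is not a square modulo `4`
  have hinv : ∀ f : G, f ∉ Subgroup.zpowers a → f * a * f⁻¹ = a⁻¹ := by
    intro f hf
    obtain ⟨r, hr1, hr2⟩ := hQ.exists_pow_notMem_pow_mem hf
    obtain ⟨-, -, h1, -⟩ := key hr1 hr2
    cases r with
    | zero => simpa using h1
    | succ r =>
      exfalso
      obtain ⟨k, hk⟩ := hn.conj_mem a (Subgroup.mem_zpowers a) (f ^ 2 ^ r)
      have h2 := conj_pow_zpow_eq (a := a) (x := f ^ 2 ^ r) (k := k) hk.symm 2 1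
      rw [← pow_mul, ← pow_succ, zpow_one, mul_one, ← mul_inv_eq_iff_eq_mul, h1,
        eq_comm, ← mul_inv_eq_one, inv_inv, ← zpow_add_one, ← orderOf_dvd_iff_zpow_eq_one, hm] at h2
      have h4 : (4 : ℤ) ∣ k ^ 2 + 1 := by
        refine dvd_trans ?_ h2
        have : 2 ^ 2 ∣ 2 ^ m := pow_dvd_pow 2 hm2
        exact_mod_cast this
      rcases Int.even_or_odd' k with ⟨c, rfl | rfl⟩ <;> ring_nf at h4 <;> lia
  refine ⟨m - 1, by lia, ?_⟩
  refine nonempty_quaternionGroup_mulEquiv (a := a) (x := x) ?_ hxa hx2 hx fun g => ?_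
  · rw [hm, ← pow_succ']
    congr 1
    lia
  · by_cases hg : g ∈ Subgroup.zpowers a
    · exact Or.inl hg
    · refine Or.inr (hC _ ?_)
      have h1 := mul_inv_eq_iff_eq_mul.1 (hinv g hg)
      have h2 : a * x⁻¹ = x⁻¹ * a⁻¹ := by
        rw [eq_inv_mul_iff_mul_eq, ← mul_assoc, hxa]
      change x⁻¹ * g * a = a * (x⁻¹ * g)
      rw [mul_assoc, h1, ← mul_assoc, ← h2, mul_assoc]

end Classification

/-! ### Groups with a least non-trivial subgroup -/

section Least

variable {G : Type*} [Group G] {p : ℕ}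

theorem isAtom_of_isLeast {K : Subgroup G} (hK : IsLeast {H : Subgroup G | H ≠ ⊥} K) :
    IsAtom K ∧ ∀ L : Subgroup G, IsAtom L → L = K := by
  refine ⟨⟨hK.1, fun L hL => ?_⟩, fun L hL => ?_⟩
  · by_contra hne
    exact hL.not_ge (hK.2 hne)
  · exact ((hL.le_iff.1 (hK.2 hL.1)).resolve_left hK.1).symm

theorem Subgroup.isAtom_of_card_prime {H : Subgroup G} (hp : p.Prime) (hH : Nat.card H = p) :
    IsAtom H := by
  have : Finite H := Nat.finite_of_card_ne_zero (hH ▸ hp.ne_zero)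
  refine ⟨fun h => ?_, fun L hL => ?_⟩
  · rw [h, Subgroup.card_bot] at hH
    exact hp.one_lt.ne hH
  · have := Subgroup.card_dvd_of_le hL.le
    rw [hH] at this
    rcases (Nat.dvd_prime hp).1 this with h | h
    · exact Subgroup.card_eq_one.1 h
    · exact absurd (Subgroup.eq_of_le_of_card_ge hL.le (by rw [h, hH])) hL.ne

/-- Every non-trivial subgroup of a `p`-group contains a subgroup of order `p`; it lies in `Ω(G)`,
and therefore equals `Ω(G)`. -/
theorem isLeast_omega (hp : p.Prime) (hG : IsPGroup p G) (hΩ : Nat.card (Omega G) = p) :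
    IsLeast {H : Subgroup G | H ≠ ⊥} (Omega G) := by
  have : Finite (Omega G) := Nat.finite_of_card_ne_zero (hΩ ▸ hp.ne_zero)
  have := Fact.mk hp
  refine ⟨(Subgroup.isAtom_of_card_prime hp hΩ).1, fun H hH => ?_⟩
  obtain ⟨h, hhH, h1⟩ := H.bot_or_exists_ne_one.resolve_left hH
  obtain ⟨k, hk1, hk2⟩ := hG.exists_pow_ne_one_pow_eq_one h1
  have hcard : Nat.card (Subgroup.zpowers (h ^ p ^ k)) = p := by
    rw [Nat.card_zpowers, orderOf_eq_prime hk2 hk1]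
  have hle : Subgroup.zpowers (h ^ p ^ k) ≤ Omega G :=
    (le_sSup ⟨Subgroup.isAtom_of_card_prime hp hcard, hcard⟩ : _ ≤ OmegaPrime G p).trans
      (le_iSup (fun q : Nat.Primes => OmegaPrime G q) ⟨p, hp⟩)
  rw [← Subgroup.eq_of_le_of_card_ge hle (by rw [hcard, hΩ])]
  exact Subgroup.zpowers_le.2 (H.pow_mem hhH _)

/-- If a least non-trivial subgroup has prime order `p`, then it is the only subgroup of order
`p`. -/
theorem mem_zpowers_of_isLeast (hp : p.Prime) {K : Subgroup G}
    (hK : IsLeast {H : Subgroup G | H ≠ ⊥} K) (hc : Nat.card K = p) (g h : G) (hg : g ≠ 1)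
    (hgp : g ^ p = 1) (hhp : h ^ p = 1) : h ∈ Subgroup.zpowers g := by
  have := Fact.mk hp
  have hle : ∀ w : G, w ≠ 1 → w ^ p = 1 → K = Subgroup.zpowers w := fun w hw hwp => by
    have hcard : Nat.card (Subgroup.zpowers w) = p := by
      rw [Nat.card_zpowers, orderOf_eq_prime hwp hw]
    have : Finite (Subgroup.zpowers w) := Nat.finite_of_card_ne_zero (hcard ▸ hp.ne_zero)
    exact Subgroup.eq_of_le_of_card_ge (hK.2 (by simpa using hw)) (by rw [hcard, hc])
  by_cases hh : h = 1
  · exact hh ▸ one_mem _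
  · rw [← hle g hg hgp, hle h hh hhp]
    exact Subgroup.mem_zpowers h

/-- The order of a least non-trivial subgroup `K` is not determined by `K₁ G` when `K` is the
whole group, but a non-trivial `p`-group quotient `G ⧸ K` forces it to be `p`: otherwise a
suitable power of an element of order `p` modulo `K` would have order `p` and lie outside `K`. -/
theorem card_eq_of_isLeast (hp : p.Prime) {K : Subgroup G} [K.Normal]
    (hK : IsLeast {H : Subgroup G | H ≠ ⊥} K) (hQ : IsPGroup p (G ⧸ K)) (hne : K ≠ ⊤) :
    Nat.card K = p := by
  have := Fact.mk hp
  obtain ⟨z, hzK, hz1⟩ := K.bot_or_exists_ne_one.resolve_left hK.1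
  have hgen : ∀ w : G, w ≠ 1 → K ≤ Subgroup.zpowers w := fun w hw => hK.2 (by simpa using hw)
  have hz : K = Subgroup.zpowers z := le_antisymm (hgen z hz1) (Subgroup.zpowers_le.2 hzK)
  suffices hzp : z ^ p = 1 by rw [hz, Nat.card_zpowers, orderOf_eq_prime hzp hz1]
  by_contra hzp
  obtain ⟨s, hs⟩ := hgen _ hzp hzK
  replace hs : z ^ ((p : ℤ) * s) = z := by rw [zpow_mul, zpow_natCast]; exact hs
  obtain ⟨f, -, hf⟩ := SetLike.exists_of_lt (lt_top_iff_ne_top.2 hne)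
  obtain ⟨k, hy, hyp⟩ := hQ.exists_pow_notMem_pow_mem hf
  generalize f ^ p ^ k = y at hy hyp
  -- `l` is prime to `p` and kills `K`, so that `y ^ l` has order `p`
  obtain ⟨l, hl⟩ : ∃ l : ℤ, l = p * s - 1 := ⟨_, rfl⟩
  have hzl : z ^ l = 1 := by rw [hl, zpow_sub, hs, zpow_one, mul_inv_cancel]
  have hwp : (y ^ l) ^ p = 1 := by
    rw [hz] at hyp
    obtain ⟨i, hi⟩ := hyp
    replace hi : z ^ i = y ^ p := hi
    rw [← zpow_natCast, zpow_comm, zpow_natCast, ← hi, zpow_comm, hzl, one_zpow]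
  have hw : y ^ l ∉ K := fun h => hy <| by
    have h1 : y = (y ^ p) ^ s * (y ^ l)⁻¹ := by
      rw [← zpow_natCast, ← zpow_mul, ← zpow_neg, ← zpow_add, hl]
      simp
    rw [h1]
    exact mul_mem (zpow_mem hyp s) (inv_mem h)
  obtain ⟨i, hi⟩ := hgen (y ^ l) (fun h => hw (h ▸ one_mem _)) hzK
  replace hi : (y ^ l) ^ i = z := hi
  apply hzp
  rw [← hi, ← zpow_natCast, zpow_comm, zpow_natCast, hwp, one_zpow]

theorem not_forall_mul_comm_quaternionGroup {r : ℕ} (hr : 1 ≤ r) :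
    ¬ ∀ u v : QuaternionGroup (2 ^ r), u * v = v * u := by
  intro h
  have h1 := h (.a 1) (.xa 0)
  rw [QuaternionGroup.a_mul_xa, QuaternionGroup.xa_mul_a, QuaternionGroup.xa.injEq] at h1
  have h2 : (((2 : ℕ) : ZMod (2 * 2 ^ r))) = 0 := by push_cast; linear_combination -h1
  rw [ZMod.natCast_eq_zero_iff] at h2
  have h3 := Nat.le_of_dvd two_pos h2
  have h4 : 2 ^ 1 ≤ 2 ^ r := Nat.pow_le_pow_right two_pos hr
  lia

/-- Here `K` is central, so `G` is abelian, which excludes the generalized quaternion groups. -/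
theorem isCyclic_of_isCyclic_quotient [Finite G] (hp : p.Prime) (hG : IsPGroup p G)
    {K : Subgroup G} [K.Normal] (hK : IsLeast {H : Subgroup G | H ≠ ⊥} K) (hc : Nat.card K = p)
    (hQ : IsCyclic (G ⧸ K)) : IsCyclic G := by
  have := Fact.mk hp
  refine (isCyclic_or_quaternionGroup hp hG
    (mem_zpowers_of_isLeast hp hK hc)).resolve_right ?_
  rintro ⟨r, hr, ⟨e⟩⟩
  have : Nontrivial G := e.symm.toEquiv.nontrivial
  have hle : (QuotientGroup.mk' K).ker ≤ Subgroup.center G := by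
    rw [QuotientGroup.ker_mk']
    exact hK.2 hG.bot_lt_center.ne'
  have hcomm := ((QuotientGroup.mk' K).isMulCommutative_of_isCyclic_of_ker_le_center
    hle).is_comm.comm
  exact not_forall_mul_comm_quaternionGroup hr fun u v =>
    e.injective (by rw [map_mul, map_mul, hcomm])

/-- Finite `p`-groups with a least non-trivial subgroup of order `p` are determined by the
quotient by that subgroup. -/
theorem nonempty_mulEquiv_of_quotient {G' : Type*} [Group G'] [Finite G] [Finite G']
    (hp : p.Prime) (hG : IsPGroup p G) (hG' : IsPGroup p G') {K : Subgroup G} {K' : Subgroup G'}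
    [K.Normal] [K'.Normal]
    (hK : IsLeast {H : Subgroup G | H ≠ ⊥} K) (hK' : IsLeast {H : Subgroup G' | H ≠ ⊥} K')
    (hc : Nat.card K = p) (hc' : Nat.card K' = p) (e : G ⧸ K ≃* G' ⧸ K') :
    Nonempty (G ≃* G') := by
  have hcard : Nat.card G = Nat.card G' := by
    rw [K.card_eq_card_quotient_mul_card_subgroup, K'.card_eq_card_quotient_mul_card_subgroup,
      hc, hc', Nat.card_congr e.toEquiv]
  by_cases hcyc : IsCyclic G
  · have : IsCyclic G' := isCyclic_of_isCyclic_quotient hp hG' hK' hc'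
      (e.isCyclic.1 (isCyclic_of_surjective _ (QuotientGroup.mk'_surjective K)))
    exact ⟨mulEquivOfCyclicCardEq hcard⟩
  · have hcyc' : ¬ IsCyclic G' := fun h => hcyc <| isCyclic_of_isCyclic_quotient hp hG hK hc
      (e.isCyclic.2 (isCyclic_of_surjective _ (QuotientGroup.mk'_surjective K')))
    obtain ⟨r, -, ⟨f⟩⟩ := (isCyclic_or_quaternionGroup hp hG
      (mem_zpowers_of_isLeast hp hK hc)).resolve_left hcyc
    obtain ⟨s, -, ⟨f'⟩⟩ := (isCyclic_or_quaternionGroup hp hG'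
      (mem_zpowers_of_isLeast hp hK' hc')).resolve_left hcyc'
    rw [← Nat.card_congr f.toEquiv, ← Nat.card_congr f'.toEquiv, Nat.card_eq_fintype_card,
      Nat.card_eq_fintype_card, QuaternionGroup.card, QuaternionGroup.card] at hcard
    obtain rfl : r = s := Nat.pow_right_injective le_rfl (by simpa using hcard)
    exact ⟨f.symm.trans f'⟩

end Least

theorem theorem4p5 {G : Type*} [Group G] (p : ℕ) (hp : p.Prime) (hG : IsPGroup p G)
    (hΩ : Nat.card (Omega G) = p)
    {G' : Type*} [Group G'] (hK : Nonempty (K₁ G ≃* K₁ G')) :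
    (∃ K' : Subgroup G', IsAtom K' ∧ (∀ L : Subgroup G', IsAtom L → L = K') ∧
      ∃ _ : K'.Normal, Nonempty (G ⧸ Omega G ≃* G' ⧸ K')) ∧
    (Finite G → 1 < Nat.card G → ¬ (Nat.card G).Prime → Nonempty (G ≃* G')) := by
  obtain ⟨e⟩ := hK
  have hK := isLeast_omega hp hG hΩ
  obtain ⟨K', hK', he⟩ := CosetSemigroup.exists_isLeast_of_mulEquiv e hK
  have hn := CosetSemigroup.normal_of_isLeast hK'
  obtain ⟨ε⟩ := CosetSemigroup.nonempty_quotient_mulEquiv e hK hK' he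
  obtain ⟨h1, h2⟩ := isAtom_of_isLeast hK'
  refine ⟨⟨K', h1, h2, hn, ⟨ε⟩⟩, fun hfin _ hnp => ?_⟩
  have hQ' : IsPGroup p (G' ⧸ K') := (hG.to_quotient _).of_equiv ε
  have hcard := (Omega G).card_eq_card_quotient_mul_card_subgroup
  have hne : K' ≠ ⊤ := by
    -- if `K'` were everything, then `G` would equal `Ω(G)`, of prime order
    rintro rfl
    rw [Nat.card_congr ε.toEquiv, ← Subgroup.index, Subgroup.index_top, one_mul, hΩ] at hcard
    exact hnp (hcard ▸ hp)
  have hc' := card_eq_of_isLeast hp hK' hQ' hne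
  have hcard' : Nat.card G = Nat.card G' := by
    rw [hcard, K'.card_eq_card_quotient_mul_card_subgroup, hΩ, hc', Nat.card_congr ε.toEquiv]
  have := Fact.mk hp
  obtain ⟨n, hn⟩ := IsPGroup.iff_card.1 hG
  have : Finite G' := Nat.finite_of_card_ne_zero (hcard' ▸ Nat.card_pos.ne')
  exact nonempty_mulEquiv_of_quotient hp hG (IsPGroup.of_card (hcard' ▸ hn)) hK hK' hΩ hc' ε
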